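/- **Theorem ($\sigma\pi\alpha$ is confluent).** Fix an infinite set of variables, ranged over by $a,b$. Terms and substitutions are given by $$M,N ::= a \mid MN \mid \lambda a.M \mid s\circ M,\qquad s,q ::= id \mid \pi_a \mid \langle s, N\diagdown a\rangle \mid s\circ q ,$$ where $\circ$ associates to the right. A context $\Gamma$ is a finite list of variables (repetitions permitted), $|\Gamma|$ is its length, and a judgement is an expression $\Gamma\vdash M$. *Free variables.* To each term $M$ assign a sequence of sets $FV(M)=\langle FV_1(M),FV_2(M),\ldots\rangle$ by $FV(a)=\langle\{a\},\emptyset,\emptyset,\ldots\rangle$, $FV(MN)=FV(M)\cup FV(N)$ (componentwise), $FV(\lambda a.M)=O_{\lambda a}(FV(M))$, $FV(s\circ M)=O_s(FV(M))$, where $O_{\lambda a}(\mathcal A)=\langle(\mathcal A_1\setminus\{a\})\cup\mathcal A_2,\mathcal A_3,\mathcal A_4,\ldots\rangle$, $O_{id}(\mathcal A)=\mathcal A$, $O_{\pi_a}(\mathcal A)=\langle\emptyset,\mathcal A_1,\mathcal A_2,\ldots\rangle$, $O_{s\circ q}(\mathcal A)=O_s(O_q(\mathcal A))$, $O_{\langle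 s,N\diagdown a\rangle}(\mathcal A)=O_s(O_{\lambda a}(\mathcal A))\cup FV(N)$. Write $fv(M)=\bigcup_{i\ge1}FV_i(M)$ and $fv(a_1,\ldots,a_k\vdash M)=fv(\lambda a_1.\cdots\lambda a_k.M)$. Put $\Uparrow_{nil}(s)=s$ and $\Uparrow_{\Sigma,a}(s)=\langle\pi_a\circ\Uparrow_\Sigma(s),a\diagdown a\rangle$. *The calculus $\sigma\pi\alpha$* (the calculus $\lambda\pi$ without its rule $(\lambda a.M)N\to\langle id,N\diagdown a\rangle\circ M$). One-step reduction $\to$ on terms and on substitutions is the closure under all term and substitution constructors of the rules $$\begin{array}{ll} s\circ\lambda a.M\to\lambda a.\langle\pi_a\circ s,\,a\diagdown a\rangle\circ M, & s\circ(MN)\to(s\circ M)(s\circ N),\\ \langle s,N\diagdown a\rangle\circ a\to N, & \langle s,N\diagdown a\rangle\circ b\to s\circ b\quad(a\ne b),\\ id\circ a\to a, & s\circ q\circ M\to(s\circ q)\circ M,\\ s\circ q\circ r\to(s\circ q)\circ r, & s\circ id\to s,\\ id\circ\pi_a\to\pi_a, & \langle s,N\diagdown a\rangle\circ\pi_a\to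 s,\\ s\circ\langle q,N\diagdown a\rangle\to\langle s\circ q,\,s\circ N\diagdown a\rangle, & \pi_a\circ b\to b\quad(a\ne b),\\ (s\circ\pi_a)\circ b\to s\circ b\quad(a\ne b), & \lambda a.M\to\lambda b.\langle\pi_b,b\diagdown a\rangle\circ M\quad(*) \end{array}$$ where $(*)$ is: $a\in fv(\lambda a.M)$ and $b\notin fv(\lambda a.M)$. One-step reduction $\rightsquigarrow$ on judgements is given by $\Gamma\vdash M_1\rightsquigarrow\Gamma\vdash M_2$ whenever $M_1\to M_2$, and $$\Gamma,a,\Delta\vdash M\;\rightsquigarrow\;\Gamma,b,\Delta\vdash\;\Uparrow_\Delta\!(\langle\pi_b,b\diagdown a\rangle)\circ M$$ whenever $a\in fv(a,\Delta\vdash M)$ and $b\notin fv(a,\Delta\vdash M)$. Let $\rightsquigarrow^{*}$ be the reflexive transitive closure of $\rightsquigarrow$. *$\alpha$-equality.* Name-free terms and substitutions are given by $U,V::=\underline n\mid UV\mid\lambda U\mid u\circ U$ ($n\ge1$) and $u,v::=id\mid\pi\mid\langle u,V\rangle\mid u\circ v$. The correspondences $(\Gamma\vdash M)\Rightarrow(|\Gamma|\vdash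 U)$ and $(\Gamma\vdash s\triangleright\Delta)\Rightarrow(|\Gamma|\vdash u)$, written below as $\Gamma\vdash M:U$ and $\Gamma\vdash s\triangleright\Delta:u$, are defined inductively by: - $\Gamma,a\vdash a:\underline1$; if $\Gamma\vdash a:\underline n$ and $a\neq b$, then $\Gamma,b\vdash a:\underline{n+1}$; - if $\Gamma\vdash M:U$ and $\Gamma\vdash N:V$, then $\Gamma\vdash MN:UV$; if $\Gamma,a\vdash M:U$, then $\Gamma\vdash\lambda a.M:\lambda U$; - if $\Gamma\vdash s\triangleright\Delta:u$ and $\Delta\vdash M:U$, then $\Gamma\vdash s\circ M:u\circ U$; - $\Gamma\vdash id\triangleright\Gamma:id$; $\;\Gamma,a\vdash\pi_a\triangleright\Gamma:\pi$; - if $\Gamma\vdash s\triangleright\Delta:u$ and $\Gamma\vdash N:V$, then $\Gamma\vdash\langle s,N\diagdown a\rangle\triangleright\Delta,a:\langle u,V\rangle$; - if $\Gamma\vdash s\triangleright\Delta:u$ and $\Delta\vdash q\triangleright\Sigma:v$, then $\Gamma\vdash s\circ q\triangleright\Sigma:u\circ v$. Write $(\Gamma\vdash M)\equiv_\alpha(\Delta\vdash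 N)$ iff there are $m$ and $U$ with $(\Gamma\vdash M)\Rightarrow(m\vdash U)$ and $(\Delta\vdash N)\Rightarrow(m\vdash U)$. **Claim.** Suppose $(\Gamma_1\vdash M_1)\equiv_\alpha(\Gamma_2\vdash M_2)$, $\;\Gamma_1\vdash M_1\rightsquigarrow^{*}\Delta_1\vdash N_1$ and $\Gamma_2\vdash M_2\rightsquigarrow^{*}\Delta_2\vdash N_2$. Then there are judgements $\Sigma_1\vdash L_1$ and $\Sigma_2\vdash L_2$ such that $\Delta_1\vdash N_1\rightsquigarrow^{*}\Sigma_1\vdash L_1$, $\;\Delta_2\vdash N_2\rightsquigarrow^{*}\Sigma_2\vdash L_2$ and $(\Sigma_1\vdash L_1)\equiv_\alpha(\Sigma_2\vdash L_2)$. -/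

import Mathlib

namespace LambdaPi

universe u

mutual

/-- Terms `M, N ::= a | M N | λ a. M | s ∘ M` over a set `V` of variables. -/
inductive Term (V : Type u) : Type u
  | var (a : V) : Term V
  | app (M N : Term V) : Term V
  | lam (a : V) (M : Term V) : Term V
  | clos (s : Subst V) (M : Term V) : Term V

/-- Substitutions `s, q ::= id | π_a | ⟨s, N ╲ a⟩ | s ∘ q`. -/
inductive Subst (V : Type u) : Type u
  | ident : Subst V
  | proj (a : V) : Subst V
  | cons (s : Subst V) (N : Term V) (a : V) : Subst V
  | comp (s q : Subst V) : Subst V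

end

/-- Contexts: finite lists of variables, repetitions permitted. The list is stored with the
rightmost variable first, so `Γ, a` is `a :: Γ`, and `Γ, a, Δ` is `Δ ++ a :: Γ`. -/
abbrev Ctx (V : Type u) : Type u := List V

/-- Judgements of the form `Γ ⊢ M` (as expressions, derivable or not). -/
structure Judgement (V : Type u) : Type u where
  ctx : Ctx V
  term : Term V

/-- Sequences `⟨A₁, A₂, A₃, …⟩` of sets of variables; `A n` is the set `A_{n+1}`. -/
abbrev Levels (V : Type u) : Type u := ℕ → Set V

/-- `O_{λ a}(A) = ⟨(A₁ \ {a}) ∪ A₂, A₃, A₄, …⟩`. -/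
def opLam {V : Type u} (a : V) (A : Levels V) : Levels V
  | 0 => (A 0 \ {a}) ∪ A 1
  | n + 1 => A (n + 2)

/-- `O_π(A) = ⟨∅, A₁, A₂, …⟩`. -/
def opProj {V : Type u} (A : Levels V) : Levels V
  | 0 => ∅
  | n + 1 => A n

/-- `⟨{a}, ∅, ∅, …⟩`. -/
def levelsVar {V : Type u} (a : V) : Levels V
  | 0 => {a}
  | _ + 1 => ∅

mutual

/-- `FV(M)`, the free variables of a term, sorted by level. -/
def FV {V : Type u} : Term V → Levels V
  | .var a => levelsVar a
  | .app M N => fun n => FV M n ∪ FV N n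
  | .lam a M => opLam a (FV M)
  | .clos s M => opSubst s (FV M)

/-- The operator `O_s`. -/
def opSubst {V : Type u} : Subst V → Levels V → Levels V
  | .ident, A => A
  | .proj _, A => opProj A
  | .cons s N a, A => fun n => opSubst s (opLam a A) n ∪ FV N n
  | .comp s q, A => opSubst s (opSubst q A)

end

/-- The set `⋃_{i ≥ 1} FV_i(M)`. -/
def freeVars {V : Type u} (M : Term V) : Set V := ⋃ n, FV M n

/-- `λ Γ. M`: `λ nil. M = M` and `λ (Σ, a). M = λ Σ. (λ a. M)`. -/
def lamCtx {V : Type u} : Ctx V → Term V → Term V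
  | [], M => M
  | a :: S, M => lamCtx S (.lam a M)

/-- The set `⋃_{i ≥ 1} FV_i(Γ ⊢ M)`, where `FV(Γ ⊢ M) = FV(λ Γ. M)`. -/
def freeVarsJ {V : Type u} (Γ : Ctx V) (M : Term V) : Set V := freeVars (lamCtx Γ M)

/-- `⇑_Δ(s)`: `⇑_nil(s) = s` and `⇑_{Σ, a}(s) = ⟨π_a ∘ ⇑_Σ(s), a ╲ a⟩`. -/
def lift {V : Type u} : Ctx V → Subst V → Subst V
  | [], s => s
  | a :: S, s => .cons (.comp (.proj a) (lift S s)) (.var a) a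

/-- The full calculus `λπ`, and `σπα`, which is `λπ` without `Beta`. -/
inductive Calculus : Type
  | lambdaPi
  | sigmaPiAlpha

mutual

/-- One-step reduction `M₁ → M₂` on terms. -/
inductive TermStep {V : Type u} (c : Calculus) : Term V → Term V → Prop
  | lam {M₁ M₂ : Term V} (a : V) : TermStep c M₁ M₂ → TermStep c (.lam a M₁) (.lam a M₂)
  | appL {M₁ M₂ : Term V} (N : Term V) :
      TermStep c M₁ M₂ → TermStep c (.app M₁ N) (.app M₂ N)
  | appR {N₁ N₂ : Term V} (M : Term V) :
      TermStep c N₁ N₂ → TermStep c (.app M N₁) (.app M N₂)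
  | closL {s₁ s₂ : Subst V} (M : Term V) :
      SubstStep c s₁ s₂ → TermStep c (.clos s₁ M) (.clos s₂ M)
  | closR {M₁ M₂ : Term V} (s : Subst V) :
      TermStep c M₁ M₂ → TermStep c (.clos s M₁) (.clos s M₂)
  | Beta (h : c = Calculus.lambdaPi) (a : V) (M N : Term V) :
      TermStep c (.app (.lam a M) N) (.clos (.cons .ident N a) M)
  | Abs (s : Subst V) (a : V) (M : Term V) :
      TermStep c (.clos s (.lam a M))
        (.lam a (.clos (.cons (.comp (.proj a) s) (.var a) a) M))
  | App (s : Subst V) (M N : Term V) :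
      TermStep c (.clos s (.app M N)) (.app (.clos s M) (.clos s N))
  | ConsVar (s : Subst V) (N : Term V) (a : V) :
      TermStep c (.clos (.cons s N a) (.var a)) N
  | New (s : Subst V) (N : Term V) (a b : V) (h : a ≠ b) :
      TermStep c (.clos (.cons s N a) (.var b)) (.clos s (.var b))
  | IdVar (a : V) : TermStep c (.clos .ident (.var a)) (.var a)
  | Clos (s q : Subst V) (M : Term V) :
      TermStep c (.clos s (.clos q M)) (.clos (.comp s q) M)
  | Proj₁ (a b : V) (h : a ≠ b) : TermStep c (.clos (.proj a) (.var b)) (.var b)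
  | Proj₂ (s : Subst V) (a b : V) (h : a ≠ b) :
      TermStep c (.clos (.comp s (.proj a)) (.var b)) (.clos s (.var b))
  | Alpha₁ (a b : V) (M : Term V)
      (ha : a ∈ freeVars (.lam a M)) (hb : b ∉ freeVars (.lam a M)) :
      TermStep c (.lam a M) (.lam b (.clos (.cons (.proj b) (.var b) a) M))

/-- One-step reduction `s₁ → s₂` on substitutions. -/
inductive SubstStep {V : Type u} (c : Calculus) : Subst V → Subst V → Prop
  | consL {s₁ s₂ : Subst V} (N : Term V) (a : V) :
      SubstStep c s₁ s₂ → SubstStep c (.cons s₁ N a) (.cons s₂ N a)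
  | consR {N₁ N₂ : Term V} (s : Subst V) (a : V) :
      TermStep c N₁ N₂ → SubstStep c (.cons s N₁ a) (.cons s N₂ a)
  | compL {s₁ s₂ : Subst V} (q : Subst V) :
      SubstStep c s₁ s₂ → SubstStep c (.comp s₁ q) (.comp s₂ q)
  | compR {q₁ q₂ : Subst V} (s : Subst V) :
      SubstStep c q₁ q₂ → SubstStep c (.comp s q₁) (.comp s q₂)
  | Ass (s q r : Subst V) :
      SubstStep c (.comp s (.comp q r)) (.comp (.comp s q) r)
  | IdR (s : Subst V) : SubstStep c (.comp s .ident) s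
  | IdShift (a : V) : SubstStep c (.comp .ident (.proj a)) (.proj a)
  | ConsShift (s : Subst V) (N : Term V) (a : V) :
      SubstStep c (.comp (.cons s N a) (.proj a)) s
  | Map (s q : Subst V) (N : Term V) (a : V) :
      SubstStep c (.comp s (.cons q N a)) (.cons (.comp s q) (.clos s N) a)

end

/-- One-step reduction `⇝` on judgements `Γ ⊢ M`. The second rule is
`Γ, a, Δ ⊢ M ⇝ Γ, b, Δ ⊢ ⇑_Δ⟨π_b, b ╲ a⟩ ∘ M`, with the side condition on the free variables
of the judgement `a, Δ ⊢ M`. -/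
inductive JudgementStep {V : Type u} (c : Calculus) : Judgement V → Judgement V → Prop
  | term {M₁ M₂ : Term V} (Γ : Ctx V) :
      TermStep c M₁ M₂ → JudgementStep c ⟨Γ, M₁⟩ ⟨Γ, M₂⟩
  | Alpha₂ (Γ Δ : Ctx V) (a b : V) (M : Term V)
      (ha : a ∈ freeVarsJ (Δ ++ [a]) M) (hb : b ∉ freeVarsJ (Δ ++ [a]) M) :
      JudgementStep c ⟨Δ ++ a :: Γ, M⟩
        ⟨Δ ++ b :: Γ, .clos (lift Δ (.cons (.proj b) (.var b) a)) M⟩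

/-- The reflexive transitive closure of `⇝` in the calculus `c`. -/
def Reduces {V : Type u} (c : Calculus) : Judgement V → Judgement V → Prop :=
  Relation.ReflTransGen (JudgementStep c)

mutual

/-- Extended name-free terms `U ::= n̲ | U V | λ U | u ∘ U` with `n ≥ 1`; here `idx n` is the
symbol for `n + 1`. -/
inductive NFTerm : Type
  | idx (n : ℕ) : NFTerm
  | app (U W : NFTerm) : NFTerm
  | lam (U : NFTerm) : NFTerm
  | clos (v : NFSubst) (U : NFTerm) : NFTerm

/-- Extended name-free substitutions `u ::= id | π | ⟨u, V⟩ | u ∘ v`. -/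
inductive NFSubst : Type
  | ident : NFSubst
  | proj : NFSubst
  | cons (v : NFSubst) (U : NFTerm) : NFSubst
  | comp (v w : NFSubst) : NFSubst

end

mutual

/-- `TermCorr Γ M U` is `(Γ ⊢ M) ⇒ (|Γ| ⊢ U)`: the name-free judgement `|Γ| ⊢ U` corresponds to
the judgement `Γ ⊢ M`. -/
inductive TermCorr {V : Type u} : Ctx V → Term V → NFTerm → Prop
  | here (Γ : Ctx V) (a : V) : TermCorr (a :: Γ) (.var a) (.idx 0)
  | there {Γ : Ctx V} {a : V} {n : ℕ} (b : V) (h : a ≠ b) :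
      TermCorr Γ (.var a) (.idx n) → TermCorr (b :: Γ) (.var a) (.idx (n + 1))
  | app {Γ : Ctx V} {M N : Term V} {U W : NFTerm} :
      TermCorr Γ M U → TermCorr Γ N W → TermCorr Γ (.app M N) (.app U W)
  | lam {Γ : Ctx V} {a : V} {M : Term V} {U : NFTerm} :
      TermCorr (a :: Γ) M U → TermCorr Γ (.lam a M) (.lam U)
  | clos {Γ Δ : Ctx V} {s : Subst V} {M : Term V} {v : NFSubst} {U : NFTerm} :
      SubstCorr Γ s Δ v → TermCorr Δ M U → TermCorr Γ (.clos s M) (.clos v U)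

/-- `SubstCorr Γ s Δ v` is `(Γ ⊢ s ▷ Δ) ⇒ (|Γ| ⊢ v)`. -/
inductive SubstCorr {V : Type u} : Ctx V → Subst V → Ctx V → NFSubst → Prop
  | ident (Γ : Ctx V) : SubstCorr Γ .ident Γ .ident
  | proj (Γ : Ctx V) (a : V) : SubstCorr (a :: Γ) (.proj a) Γ .proj
  | cons {Γ Δ : Ctx V} {s : Subst V} {N : Term V} {v : NFSubst} {U : NFTerm} (a : V) :
      SubstCorr Γ s Δ v → TermCorr Γ N U → SubstCorr Γ (.cons s N a) (a :: Δ) (.cons v U)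
  | comp {Γ Δ S : Ctx V} {s q : Subst V} {v w : NFSubst} :
      SubstCorr Γ s Δ v → SubstCorr Δ q S w → SubstCorr Γ (.comp s q) S (.comp v w)

end

/-- `α`-equality of judgements: `(Γ ⊢ M) ⇒ (m ⊢ U)` and `(Δ ⊢ N) ⇒ (m ⊢ U)` for some `m`
and `U`. -/
def AlphaEq {V : Type u} (J K : Judgement V) : Prop :=
  ∃ (m : ℕ) (U : NFTerm),
    (J.ctx.length = m ∧ TermCorr J.ctx J.term U) ∧ (K.ctx.length = m ∧ TermCorr K.ctx K.term U)

end LambdaPi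

/-!
The proof computes normal forms instead of closing critical pairs.

A name-free term `U` denotes a pure de Bruijn term `den U`, obtained by performing all explicit
substitutions; a name-free substitution denotes a function from indices to pure terms. Each step
of `σπα`, the two renaming rules included, preserves this denotation, because the renaming
substitutions `⟨π_b, b ╲ a⟩` denote the identity (`TermStep.sound`, `Reduces.sound`).

Conversely, every typable judgement `Γ ⊢ M` with `M : U` reduces to a judgement that corresponds
to `den U` (`exists_reduces_toNF`). The rules other than renaming bring `M` into a form whose only
explicit substitutions are strings of projections at variables, as in `(π_c ∘ π_a) ∘ a`, which
skip a binder that has the name of the variable (`TermCorr.exists_semiNormal`). If such a binder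
exists, it satisfies the side condition of the renaming rules (`SemiNormal.mem_freeVarsJ`), so it
can be given a fresh name. Whether a binder causes such a clash depends only on the names of the
context and on the denotation, so the binders can be treated one after the other: first the
context (`exists_unshadowed`), then the abstractions from the outside to the inside, by induction
on the denotation (`exists_pure_of_unshadowed`). When no clash is left, no substitution is left.

Judgements that are `α`-equal share their denotation; hence so do their reducts, which therefore
reduce further to judgements that correspond to one and the same name-free term.
-/

namespace LambdaPi

universe u

/-! ### Pure de Bruijn terms -/

/-- Pure de Bruijn terms: name-free terms without explicit substitutions. -/
inductive Lam : Type
  | var (n : ℕ) : Lam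
  | app (S T : Lam) : Lam
  | lam (T : Lam) : Lam

namespace Lam

/-- Extension of a renaming under a binder. -/
def upRen (f : ℕ → ℕ) : ℕ → ℕ
  | 0 => 0
  | n + 1 => f n + 1

/-- Action of a renaming of the indices. -/
def rename : (ℕ → ℕ) → Lam → Lam
  | f, var n => var (f n)
  | f, app S T => app (rename f S) (rename f T)
  | f, lam T => lam (rename (upRen f) T)

/-- Extension of a simultaneous substitution under a binder. -/
def up (f : ℕ → Lam) : ℕ → Lam
  | 0 => var 0
  | n + 1 => rename Nat.succ (f n)

/-- Simultaneous capture-avoiding substitution. -/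
def subst : (ℕ → Lam) → Lam → Lam
  | f, var n => f n
  | f, app S T => app (subst f S) (subst f T)
  | f, lam T => lam (subst (up f) T)

theorem subst_rename (T : Lam) (f : ℕ → Lam) (g : ℕ → ℕ) :
    subst f (rename g T) = subst (fun n => f (g n)) T := by
  induction T generalizing f g with
  | var n => rfl
  | app S T ihS ihT => simp only [rename, subst, ihS, ihT]
  | lam T ih =>
    simp only [rename, subst, ih]
    congr 2
    funext n
    cases n <;> rfl

theorem rename_eq_subst (T : Lam) (g : ℕ → ℕ) : rename g T = subst (fun n => var (g n)) T := by
  induction T generalizing g with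
  | var n => rfl
  | app S T ihS ihT => simp only [rename, subst, ihS, ihT]
  | lam T ih =>
    simp only [rename, subst, ih]
    congr 2
    funext n
    cases n <;> rfl

theorem rename_rename (T : Lam) (f g : ℕ → ℕ) :
    rename f (rename g T) = rename (fun n => f (g n)) T := by
  rw [rename_eq_subst, subst_rename, ← rename_eq_subst T (fun n => f (g n))]

theorem rename_subst (T : Lam) (f : ℕ → Lam) (g : ℕ → ℕ) :
    rename g (subst f T) = subst (fun n => rename g (f n)) T := by
  induction T generalizing f g with
  | var n => rfl
  | app S T ihS ihT => simp only [rename, subst, ihS, ihT]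
  | lam T ih =>
    simp only [rename, subst, ih]
    congr 2
    funext n
    cases n with
    | zero => rfl
    | succ n => simp only [up, rename_rename]; rfl

theorem subst_subst (T : Lam) (f g : ℕ → Lam) :
    subst f (subst g T) = subst (fun n => subst f (g n)) T := by
  induction T generalizing f g with
  | var n => rfl
  | app S T ihS ihT => simp only [subst, ihS, ihT]
  | lam T ih =>
    simp only [subst, ih]
    congr 2
    funext n
    cases n with
    | zero => rfl
    | succ n => simp only [up, subst_rename, rename_subst]

theorem subst_var (T : Lam) : subst var T = T := by
  induction T with
  | var n => rfl
  | app S T ihS ihT => simp only [subst, ihS, ihT]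
  | lam T ih =>
    have h : up var = var := by funext n; cases n <;> rfl
    simp only [subst, h, ih]

/-- `T.Free n`: the index `n` occurs free in `T`. -/
def Free : Lam → ℕ → Prop
  | var m, n => m = n
  | app S T, n => Free S n ∨ Free T n
  | lam T, n => Free T (n + 1)

/-- The inclusion of pure terms into extended name-free terms. -/
def toNF : Lam → NFTerm
  | var n => .idx n
  | app S T => .app (toNF S) (toNF T)
  | lam T => .lam (toNF T)

end Lam

mutual

/-- The pure term denoted by a name-free term, obtained by performing all its substitutions. -/
def den : NFTerm → Lam
  | .idx n => .var n
  | .app U W => .app (den U) (den W)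
  | .lam U => .lam (den U)
  | .clos v U => Lam.subst (denSubst v) (den U)

/-- The simultaneous substitution denoted by a name-free substitution. -/
def denSubst : NFSubst → ℕ → Lam
  | .ident => Lam.var
  | .proj => fun n => .var (n + 1)
  | .cons v U => fun n => Nat.casesOn n (den U) (denSubst v)
  | .comp v w => fun n => Lam.subst (denSubst v) (denSubst w n)

end

variable {V : Type u}

/-! ### Reduction preserves the denotation -/

theorem up_denSubst (v : NFSubst) :
    denSubst (.cons (.comp .proj v) (.idx 0)) = Lam.up (denSubst v) := by
  funext n
  cases n with
  | zero => rfl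
  | succ n => exact (Lam.rename_eq_subst _ _).symm

theorem denSubst_cons_proj : denSubst (.cons .proj (.idx 0)) = Lam.var := by
  funext n
  cases n <;> rfl

mutual

/-- A reduct of a typable term is typable in the same context and has the same denotation. -/
theorem TermStep.sound {M N : Term V} (h : TermStep .sigmaPiAlpha M N) {Γ : Ctx V} {U : NFTerm}
    (hM : TermCorr Γ M U) : ∃ W, TermCorr Γ N W ∧ den W = den U := by
  cases h with
  | lam a h =>
    cases hM with | lam hM =>
    obtain ⟨W, hW, e⟩ := h.sound hM
    exact ⟨_, .lam hW, by simp only [den, e]⟩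
  | appL _ h =>
    cases hM with | app hM hN =>
    obtain ⟨W, hW, e⟩ := h.sound hM
    exact ⟨_, .app hW hN, by simp only [den, e]⟩
  | appR _ h =>
    cases hM with | app hM hN =>
    obtain ⟨W, hW, e⟩ := h.sound hN
    exact ⟨_, .app hM hW, by simp only [den, e]⟩
  | closL _ h =>
    cases hM with | clos hs hM =>
    obtain ⟨w, hw, e⟩ := h.sound hs
    exact ⟨_, .clos hw hM, by simp only [den, e]⟩
  | closR _ h =>
    cases hM with | clos hs hM =>
    obtain ⟨W, hW, e⟩ := h.sound hM
    exact ⟨_, .clos hs hW, by simp only [den, e]⟩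
  | Beta h => cases h
  | Abs s a M =>
    cases hM with | clos hs hM =>
    cases hM with | lam hM =>
    exact ⟨_, .lam (.clos (.cons a (.comp (.proj _ a) hs) (.here _ a)) hM), by
      simp only [den, up_denSubst, Lam.subst]⟩
  | App s M N =>
    cases hM with | clos hs hM =>
    cases hM with | app hM hN =>
    exact ⟨_, .app (.clos hs hM) (.clos hs hN), rfl⟩
  | ConsVar s N a =>
    cases hM with | clos hs hM =>
    cases hs with | cons _ hs hN =>
    cases hM with
    | here => exact ⟨_, hN, rfl⟩
    | there _ h _ => exact absurd rfl h
  | New s N a b h =>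
    cases hM with | clos hs hM =>
    cases hs with | cons _ hs hN =>
    cases hM with
    | here => exact absurd rfl h
    | there _ _ hM => exact ⟨_, .clos hs hM, rfl⟩
  | IdVar a =>
    cases hM with | clos hs hM =>
    cases hs
    exact ⟨_, hM, (Lam.subst_var _).symm⟩
  | Clos s q M =>
    cases hM with | clos hs hM =>
    cases hM with | clos hq hM =>
    exact ⟨_, .clos (.comp hs hq) hM, (Lam.subst_subst _ _ _).symm⟩
  | Proj₁ a b h =>
    cases hM with | clos hs hM =>
    cases hs
    cases hM with
    | here => exact ⟨_, .there a h.symm (.here _ _), rfl⟩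
    | there c hc hM => exact ⟨_, .there a h.symm (.there c hc hM), rfl⟩
  | Proj₂ s a b h =>
    cases hM with | clos hs hM =>
    cases hs with | comp hs hp =>
    cases hp
    cases hM with
    | here => exact ⟨_, .clos hs (.there a h.symm (.here _ _)), rfl⟩
    | there c hc hM => exact ⟨_, .clos hs (.there a h.symm (.there c hc hM)), rfl⟩
  | Alpha₁ a b M =>
    cases hM with | lam hM =>
    exact ⟨_, .lam (.clos (.cons a (.proj _ b) (.here _ b)) hM), by
      simp only [den, denSubst_cons_proj, Lam.subst_var]⟩

/-- A reduct of a typable substitution has the same type and the same denotation. -/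
theorem SubstStep.sound {s q : Subst V} (h : SubstStep .sigmaPiAlpha s q) {Γ Δ : Ctx V}
    {v : NFSubst} (hs : SubstCorr Γ s Δ v) :
    ∃ w, SubstCorr Γ q Δ w ∧ denSubst w = denSubst v := by
  cases h with
  | consL _ a h =>
    cases hs with | cons _ hs hN =>
    obtain ⟨w, hw, e⟩ := h.sound hs
    exact ⟨_, .cons a hw hN, by simp only [denSubst, e]⟩
  | consR _ a h =>
    cases hs with | cons _ hs hN =>
    obtain ⟨w, hw, e⟩ := h.sound hN
    exact ⟨_, .cons a hs hw, by simp only [denSubst, e]⟩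
  | compL _ h =>
    cases hs with | comp hs hq =>
    obtain ⟨w, hw, e⟩ := h.sound hs
    exact ⟨_, .comp hw hq, by simp only [denSubst, e]⟩
  | compR _ h =>
    cases hs with | comp hs hq =>
    obtain ⟨w, hw, e⟩ := h.sound hq
    exact ⟨_, .comp hs hw, by simp only [denSubst, e]⟩
  | Ass s q r =>
    cases hs with | comp hs hq =>
    cases hq with | comp hq hr =>
    exact ⟨_, .comp (.comp hs hq) hr, by simp only [denSubst, Lam.subst_subst]⟩
  | IdR s =>
    cases hs with | comp hs hq =>
    cases hq
    exact ⟨_, hs, rfl⟩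
  | IdShift a =>
    cases hs with | comp hs hq =>
    cases hs
    exact ⟨_, hq, by simp only [denSubst, Lam.subst_var]⟩
  | ConsShift s N a =>
    cases hs with | comp hs hq =>
    cases hq
    cases hs with | cons _ hs hN =>
    exact ⟨_, hs, rfl⟩
  | Map s q N a =>
    cases hs with | comp hs hq =>
    cases hq with | cons _ hq hN =>
    refine ⟨_, .cons a (.comp hs hq) (.clos hs hN), ?_⟩
    funext n
    cases n <;> rfl

end

/-- Many-step `σπα`-reduction of terms. -/
abbrev TermRed : Term V → Term V → Prop :=
  Relation.ReflTransGen (TermStep .sigmaPiAlpha)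

/-- Many-step `σπα`-reduction of substitutions. -/
abbrev SubstRed : Subst V → Subst V → Prop :=
  Relation.ReflTransGen (SubstStep .sigmaPiAlpha)

theorem TermRed.sound {M N : Term V} (h : TermRed M N) {Γ : Ctx V} {U : NFTerm}
    (hM : TermCorr Γ M U) : ∃ W, TermCorr Γ N W ∧ den W = den U := by
  induction h with
  | refl => exact ⟨U, hM, rfl⟩
  | tail _ h ih =>
    obtain ⟨W, hW, e⟩ := ih
    obtain ⟨W', hW', e'⟩ := h.sound hW
    exact ⟨W', hW', e'.trans e⟩

theorem SubstRed.sound {s q : Subst V} (h : SubstRed s q) {Γ Δ : Ctx V} {v : NFSubst}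
    (hs : SubstCorr Γ s Δ v) : ∃ w, SubstCorr Γ q Δ w ∧ denSubst w = denSubst v := by
  induction h with
  | refl => exact ⟨v, hs, rfl⟩
  | tail _ h ih =>
    obtain ⟨W, hW, e⟩ := ih
    obtain ⟨W', hW', e'⟩ := h.sound hW
    exact ⟨W', hW', e'.trans e⟩

/-- Lifting `⟨π_b, b ╲ a⟩` over a context gives a typable substitution that denotes the
identity. -/
theorem exists_corr_lift (Γ Δ : Ctx V) (a b : V) :
    ∃ v, SubstCorr (Δ ++ b :: Γ) (lift Δ (.cons (.proj b) (.var b) a)) (Δ ++ a :: Γ) v ∧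
      denSubst v = Lam.var := by
  induction Δ with
  | nil => exact ⟨_, .cons a (.proj Γ b) (.here Γ b), denSubst_cons_proj⟩
  | cons c Δ ih =>
    obtain ⟨v, hv, e⟩ := ih
    refine ⟨_, .cons c (.comp (.proj _ c) hv) (.here _ c), ?_⟩
    rw [up_denSubst, e]
    funext n
    cases n <;> rfl

theorem corr_lift {Γ Δ : Ctx V} {M : Term V} {U : NFTerm} {a : V} (b : V)
    (hM : TermCorr (Δ ++ a :: Γ) M U) :
    ∃ W, TermCorr (Δ ++ b :: Γ) (.clos (lift Δ (.cons (.proj b) (.var b) a)) M) W ∧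
      den W = den U := by
  obtain ⟨v, hv, e⟩ := exists_corr_lift Γ Δ a b
  exact ⟨_, .clos hv hM, by simp only [den, e, Lam.subst_var]⟩

theorem Reduces.sound {J K : Judgement V} (h : Reduces .sigmaPiAlpha J K) {U : NFTerm}
    (hJ : TermCorr J.ctx J.term U) :
    K.ctx.length = J.ctx.length ∧ ∃ W, TermCorr K.ctx K.term W ∧ den W = den U := by
  induction h with
  | refl => exact ⟨rfl, U, hJ, rfl⟩
  | tail _ h ih =>
    obtain ⟨hl, W, hW, e⟩ := ih
    cases h with
    | term Γ h =>
      obtain ⟨W', hW', e'⟩ := h.sound hW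
      exact ⟨hl, W', hW', e'.trans e⟩
    | Alpha₂ Γ Δ a b M ha hb =>
      obtain ⟨W', hW', e'⟩ := corr_lift b hW
      exact ⟨by simpa using hl, W', hW', e'.trans e⟩

/-! ### Congruence of many-step reduction -/

theorem TermRed.lam {M N : Term V} (a : V) (h : TermRed M N) : TermRed (.lam a M) (.lam a N) :=
  Relation.ReflTransGen.lift (Term.lam a) (fun _ _ h => TermStep.lam a h) _ _ h

theorem TermRed.app {M M' N N' : Term V} (h : TermRed M M') (h' : TermRed N N') :
    TermRed (.app M N) (.app M' N') :=
  (Relation.ReflTransGen.lift (Term.app · N) (fun _ _ h => TermStep.appL N h) _ _ h).trans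
    (Relation.ReflTransGen.lift (Term.app M' ·) (fun _ _ h => TermStep.appR M' h) _ _ h')

theorem TermRed.clos {s s' : Subst V} {M M' : Term V} (h : SubstRed s s') (h' : TermRed M M') :
    TermRed (.clos s M) (.clos s' M') :=
  (Relation.ReflTransGen.lift (Term.clos · M) (fun _ _ h => TermStep.closL M h) _ _ h).trans
    (Relation.ReflTransGen.lift (Term.clos s' ·) (fun _ _ h => TermStep.closR s' h) _ _ h')

theorem SubstRed.cons {s s' : Subst V} {N N' : Term V} (a : V) (h : SubstRed s s')
    (h' : TermRed N N') : SubstRed (.cons s N a) (.cons s' N' a) :=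
  (Relation.ReflTransGen.lift (Subst.cons · N a) (fun _ _ h => SubstStep.consL N a h) _ _ h).trans
    (Relation.ReflTransGen.lift (Subst.cons s' · a) (fun _ _ h => SubstStep.consR s' a h) _ _ h')

theorem SubstRed.comp {s s' q q' : Subst V} (h : SubstRed s s') (h' : SubstRed q q') :
    SubstRed (.comp s q) (.comp s' q') :=
  (Relation.ReflTransGen.lift (Subst.comp · q) (fun _ _ h => SubstStep.compL q h) _ _ h).trans
    (Relation.ReflTransGen.lift (Subst.comp s' ·) (fun _ _ h => SubstStep.compR s' h) _ _ h')

theorem Reduces.of_termRed {M N : Term V} (Γ : Ctx V) (h : TermRed M N) :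
    Reduces .sigmaPiAlpha ⟨Γ, M⟩ ⟨Γ, N⟩ :=
  Relation.ReflTransGen.lift (fun M => (⟨Γ, M⟩ : Judgement V))
    (fun _ _ h => JudgementStep.term Γ h) _ _ h

/-! ### Normalization without renaming of bound variables -/

/-- `ProjString p a`: the substitution `p` has the form `(π_{a₁} ∘ π_{a₂}) ∘ ⋯ ∘ π_{aₖ}` with
`k ≥ 1`, bracketed to the left, and `aₖ = a`. -/
inductive ProjString : Subst V → V → Prop
  | proj (a : V) : ProjString (.proj a) a
  | comp {p : Subst V} {b : V} (a : V) : ProjString p b → ProjString (.comp p (.proj a)) a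

/-- The forms that a variable occurrence can take when only renaming can simplify it further:
a variable `a`, or `p ∘ a` where `p` is a string of projections ending in `π_a`, which skips a
binder of the same name. -/
inductive Leaf : Term V → Prop
  | var (a : V) : Leaf (.var a)
  | clos {p : Subst V} {a : V} : ProjString p a → Leaf (.clos p (.var a))

/-- Terms built from `Leaf`s by application and abstraction. The typable normal forms of
the calculus without the two renaming rules are of this kind. -/
inductive SemiNormal : Term V → Prop
  | leaf {M : Term V} : Leaf M → SemiNormal M
  | app {M N : Term V} : SemiNormal M → SemiNormal N → SemiNormal (.app M N)
  | lam {M : Term V} (a : V) : SemiNormal M → SemiNormal (.lam a M)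

/-- Normal substitutions all of whose entries satisfy `P`. -/
inductive NormalSubst (P : Term V → Prop) : Subst V → Prop
  | ident : NormalSubst P .ident
  | string {p : Subst V} {a : V} : ProjString p a → NormalSubst P p
  | cons {s : Subst V} {N : Term V} (a : V) :
      NormalSubst P s → P N → NormalSubst P (.cons s N a)

variable {P : Term V → Prop}

theorem NormalSubst.comp_proj {s : Subst V} (hs : NormalSubst P s) {Γ Δ : Ctx V} {a : V}
    {v : NFSubst} (ht : SubstCorr Γ (.comp s (.proj a)) Δ v) :
    ∃ q, SubstRed (.comp s (.proj a)) q ∧ NormalSubst P q := by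
  cases hs with
  | ident => exact ⟨_, .single (.IdShift a), .string (.proj a)⟩
  | string hp => exact ⟨_, .refl, .string (.comp a hp)⟩
  | cons b hs hN =>
    cases ht with | comp ht hq =>
    cases hq
    cases ht
    exact ⟨_, .single (.ConsShift _ _ _), hs⟩

theorem NormalSubst.comp_string {s p : Subst V} {a : V} (hs : NormalSubst P s)
    (hp : ProjString p a) {Γ Δ : Ctx V} {v : NFSubst} (ht : SubstCorr Γ (.comp s p) Δ v) :
    ∃ q, SubstRed (.comp s p) q ∧ NormalSubst P q := by
  induction hp generalizing Δ v with
  | proj a => exact hs.comp_proj ht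
  | comp a hp ih =>
    cases ht with | comp ht hq =>
    cases hq with | comp hq hr =>
    have hc := SubstCorr.comp ht hq
    obtain ⟨q, hq, hn⟩ := ih hc
    obtain ⟨w, hw, -⟩ := hq.sound hc
    obtain ⟨r, hr, hn'⟩ := hn.comp_proj (.comp hw hr)
    exact ⟨r, (Relation.ReflTransGen.single (.Ass _ _ _)).trans ((hq.comp .refl).trans hr), hn'⟩

theorem ProjString.clos_var {p : Subst V} {a : V} (hp : ProjString p a) (x : V) :
    ∃ N, TermRed (.clos p (.var x)) N ∧ Leaf N := by
  induction hp with
  | proj a =>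
    by_cases h : a = x
    · subst h
      exact ⟨_, .refl, .clos (.proj a)⟩
    · exact ⟨_, .single (.Proj₁ _ _ h), .var x⟩
  | comp a hp ih =>
    by_cases h : a = x
    · subst h
      exact ⟨_, .refl, .clos (.comp a hp)⟩
    · obtain ⟨N, hN, hl⟩ := ih
      exact ⟨N, .head (.Proj₂ _ _ _ h) hN, hl⟩

theorem NormalSubst.clos_var (hP : ∀ N, Leaf N → P N) {s : Subst V} (hs : NormalSubst P s)
    (x : V) : ∃ N, TermRed (.clos s (.var x)) N ∧ P N := by
  induction hs with
  | ident => exact ⟨_, .single (.IdVar x), hP _ (.var x)⟩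
  | string hp =>
    obtain ⟨N, hN, hl⟩ := hp.clos_var x
    exact ⟨N, hN, hP N hl⟩
  | cons a hs hN ih =>
    by_cases h : a = x
    · subst h
      exact ⟨_, .single (.ConsVar _ _ _), hN⟩
    · obtain ⟨N, hN, hl⟩ := ih
      exact ⟨N, .head (.New _ _ _ _ h) hN, hl⟩

theorem NormalSubst.clos_leaf (hP : ∀ N, Leaf N → P N) {s : Subst V} (hs : NormalSubst P s)
    {M : Term V} (hM : Leaf M) {Γ : Ctx V} {U : NFTerm} (ht : TermCorr Γ (.clos s M) U) :
    ∃ N, TermRed (.clos s M) N ∧ P N := by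
  cases hM with
  | var x => exact hs.clos_var hP x
  | clos hp =>
    cases ht with | clos ht hM =>
    cases hM with | clos hq _ =>
    obtain ⟨q, hq, hn⟩ := hs.comp_string hp (.comp ht hq)
    obtain ⟨N, hN, hl⟩ := hn.clos_var hP _
    exact ⟨N, .head (.Clos _ _ _) ((TermRed.clos hq .refl).trans hN), hl⟩

theorem ProjString.proj_comp {p : Subst V} {a : V} (hp : ProjString p a) (c : V) :
    ∃ q, SubstRed (.comp (.proj c) p) q ∧ ProjString q a := by
  induction hp with
  | proj a => exact ⟨_, .refl, .comp a (.proj c)⟩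
  | comp a hp ih =>
    obtain ⟨q, hq, hn⟩ := ih
    exact ⟨_, .head (.Ass _ _ _) (hq.comp .refl), .comp a hn⟩

/-- `P` is closed under weakening: `π_c ∘ N` reduces to a term in `P` for every `N` in `P`. -/
def WeakeningClosed (P : Term V → Prop) : Prop :=
  ∀ (c : V) (N : Term V) (Γ : Ctx V) (U : NFTerm), P N → TermCorr Γ (.clos (.proj c) N) U →
    ∃ N', TermRed (.clos (.proj c) N) N' ∧ P N'

theorem NormalSubst.proj_comp (hw : WeakeningClosed P) {s : Subst V} (hs : NormalSubst P s)
    {Γ Δ : Ctx V} {c : V} {v : NFSubst} (ht : SubstCorr Γ (.comp (.proj c) s) Δ v) :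
    ∃ q, SubstRed (.comp (.proj c) s) q ∧ NormalSubst P q := by
  induction hs generalizing Δ v with
  | ident => exact ⟨_, .single (.IdR _), .string (.proj c)⟩
  | string hp =>
    obtain ⟨q, hq, hn⟩ := hp.proj_comp c
    exact ⟨q, hq, .string hn⟩
  | cons a hs hN ih =>
    cases ht with | comp hc ht =>
    cases ht with | cons _ ht htN =>
    obtain ⟨q, hq, hn⟩ := ih (.comp hc ht)
    obtain ⟨N', hN', hP⟩ := hw _ _ _ _ hN (.clos hc htN)
    exact ⟨_, .head (.Map _ _ _ _) (SubstRed.cons a hq hN'), .cons a hn hP⟩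

theorem NormalSubst.clos_semiNormal (hP : ∀ N, Leaf N → P N) (hP' : ∀ N, P N → SemiNormal N)
    (hw : WeakeningClosed P) {s : Subst V} (hs : NormalSubst P s) {M : Term V}
    (hM : SemiNormal M) {Γ : Ctx V} {U : NFTerm} (ht : TermCorr Γ (.clos s M) U) :
    ∃ N, TermRed (.clos s M) N ∧ SemiNormal N := by
  induction hM generalizing Γ U s with
  | leaf hM =>
    obtain ⟨N, hN, hl⟩ := hs.clos_leaf hP hM ht
    exact ⟨N, hN, hP' N hl⟩
  | app hM hN ihM ihN =>
    cases ht with | clos ht hMN =>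
    cases hMN with | app htM htN =>
    obtain ⟨M', hM', hnM⟩ := ihM hs (.clos ht htM)
    obtain ⟨N', hN', hnN⟩ := ihN hs (.clos ht htN)
    exact ⟨_, .head (.App _ _ _) (hM'.app hN'), .app hnM hnN⟩
  | lam a hM ih =>
    cases ht with | clos ht htM =>
    cases htM with | lam htM =>
    have hc := SubstCorr.comp (.proj _ a) ht
    obtain ⟨q, hq, hn⟩ := hs.proj_comp hw hc
    obtain ⟨w, hwt, -⟩ := hq.sound hc
    obtain ⟨M', hM', hnM⟩ := ih (.cons a hn (hP _ (.var a)))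
      (.clos (.cons a hwt (.here _ a)) htM)
    exact ⟨_, .head (.Abs _ _ _)
      (TermRed.lam a ((TermRed.clos (SubstRed.cons a hq .refl) .refl).trans hM')), .lam a hnM⟩

theorem weakeningClosed_leaf : WeakeningClosed (Leaf (V := V)) := fun c _ _ _ hN ht =>
  NormalSubst.clos_leaf (fun _ h => h) (.string (.proj c)) hN ht

/-- As usual for de Bruijn terms, weakening of arbitrary terms is treated first, by means of
substitutions whose entries are variables only. -/
theorem weakeningClosed_semiNormal : WeakeningClosed (SemiNormal (V := V)) :=
  fun c _ _ _ hN ht => NormalSubst.clos_semiNormal (P := Leaf) (fun _ h => h) (fun _ h => .leaf h)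
    weakeningClosed_leaf (.string (.proj c)) hN ht

theorem exists_semiNormal_clos {s : Subst V} (hs : NormalSubst SemiNormal s) {M : Term V}
    (hM : SemiNormal M) {Γ : Ctx V} {U : NFTerm} (ht : TermCorr Γ (.clos s M) U) :
    ∃ N, TermRed (.clos s M) N ∧ SemiNormal N :=
  hs.clos_semiNormal (fun _ h => .leaf h) (fun _ h => h) weakeningClosed_semiNormal hM ht

theorem exists_normalSubst_comp {s q : Subst V} (hs : NormalSubst SemiNormal s)
    (hq : NormalSubst SemiNormal q) {Γ Δ : Ctx V} {v : NFSubst}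
    (ht : SubstCorr Γ (.comp s q) Δ v) :
    ∃ r, SubstRed (.comp s q) r ∧ NormalSubst SemiNormal r := by
  induction hq generalizing Δ v with
  | ident => exact ⟨s, .single (.IdR _), hs⟩
  | string hp => exact hs.comp_string hp ht
  | cons a hq hN ih =>
    cases ht with | comp hst ht =>
    cases ht with | cons _ ht htN =>
    obtain ⟨r, hr, hn⟩ := ih (.comp hst ht)
    obtain ⟨N', hN', hn'⟩ := exists_semiNormal_clos hs hN (.clos hst htN)
    exact ⟨_, .head (.Map _ _ _ _) (SubstRed.cons a hr hN'), .cons a hn hn'⟩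

mutual

theorem TermCorr.exists_semiNormal {Γ : Ctx V} {M : Term V} {U : NFTerm} (h : TermCorr Γ M U) :
    ∃ N, TermRed M N ∧ SemiNormal N := by
  cases h with
  | here Γ a => exact ⟨_, .refl, .leaf (.var a)⟩
  | there b _ _ => exact ⟨_, .refl, .leaf (.var _)⟩
  | app hM hN =>
    obtain ⟨M', hM', hn⟩ := hM.exists_semiNormal
    obtain ⟨N', hN', hn'⟩ := hN.exists_semiNormal
    exact ⟨_, hM'.app hN', .app hn hn'⟩
  | lam hM =>
    obtain ⟨M', hM', hn⟩ := hM.exists_semiNormal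
    exact ⟨_, hM'.lam _, .lam _ hn⟩
  | clos hs hM =>
    obtain ⟨M', hM', hn⟩ := hM.exists_semiNormal
    obtain ⟨s', hs', hn'⟩ := hs.exists_normalSubst
    obtain ⟨W, hW, -⟩ := hM'.sound hM
    obtain ⟨w, hw, -⟩ := hs'.sound hs
    obtain ⟨N, hN, hnN⟩ := exists_semiNormal_clos hn' hn (.clos hw hW)
    exact ⟨N, (TermRed.clos hs' hM').trans hN, hnN⟩

theorem SubstCorr.exists_normalSubst {Γ Δ : Ctx V} {s : Subst V} {v : NFSubst}
    (h : SubstCorr Γ s Δ v) : ∃ q, SubstRed s q ∧ NormalSubst SemiNormal q := by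
  cases h with
  | ident => exact ⟨_, .refl, .ident⟩
  | proj Γ a => exact ⟨_, .refl, .string (.proj a)⟩
  | cons a hs hN =>
    obtain ⟨N', hN', hn⟩ := hN.exists_semiNormal
    obtain ⟨s', hs', hn'⟩ := hs.exists_normalSubst
    exact ⟨_, SubstRed.cons a hs' hN', .cons a hn' hn⟩
  | comp hs hq =>
    obtain ⟨s', hs', hn⟩ := hs.exists_normalSubst
    obtain ⟨q', hq', hn'⟩ := hq.exists_normalSubst
    obtain ⟨v, hv, -⟩ := hs'.sound hs
    obtain ⟨w, hw, -⟩ := hq'.sound hq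
    obtain ⟨r, hr, hnr⟩ := exists_normalSubst_comp hn hn' (.comp hv hw)
    exact ⟨r, (hs'.comp hq').trans hr, hnr⟩

end

/-! ### Free variables -/

/-- The union of the levels is finite. -/
def FiniteLevels (A : Levels V) : Prop := (⋃ n, A n).Finite

theorem FiniteLevels.opLam {A : Levels V} (h : FiniteLevels A) (a : V) :
    FiniteLevels (opLam a A) := by
  refine Set.Finite.subset h (Set.iUnion_subset fun n => ?_)
  cases n with
  | zero =>
    exact Set.union_subset (Set.sdiff_subset.trans (Set.subset_iUnion A 0)) (Set.subset_iUnion A 1)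
  | succ n => exact Set.subset_iUnion A (n + 2)

theorem FiniteLevels.opProj {A : Levels V} (h : FiniteLevels A) : FiniteLevels (opProj A) := by
  refine Set.Finite.subset h (Set.iUnion_subset fun n => ?_)
  cases n with
  | zero => exact Set.empty_subset _
  | succ n => exact Set.subset_iUnion A n

theorem FiniteLevels.union {A B : Levels V} (hA : FiniteLevels A) (hB : FiniteLevels B) :
    FiniteLevels (fun n => A n ∪ B n) := by
  unfold FiniteLevels
  rw [Set.iUnion_union_distrib]
  exact Set.Finite.union hA hB

mutual

theorem finiteLevels_FV : (M : Term V) → FiniteLevels (FV M)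
  | .var a => by
    refine Set.Finite.subset (Set.finite_singleton a) (Set.iUnion_subset fun n => ?_)
    cases n with
    | zero => exact subset_rfl
    | succ n => exact Set.empty_subset _
  | .app M N => by
    rw [FV]
    exact (finiteLevels_FV M).union (finiteLevels_FV N)
  | .lam a M => by
    rw [FV]
    exact (finiteLevels_FV M).opLam a
  | .clos s M => by
    rw [FV]
    exact finiteLevels_opSubst s _ (finiteLevels_FV M)

theorem finiteLevels_opSubst : (s : Subst V) → (A : Levels V) → FiniteLevels A →
    FiniteLevels (opSubst s A)
  | .ident, A, h => by
    rw [opSubst]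
    exact h
  | .proj _, A, h => by
    rw [opSubst]
    exact h.opProj
  | .cons s N a, A, h => by
    rw [opSubst]
    exact (finiteLevels_opSubst s _ (h.opLam a)).union (finiteLevels_FV N)
  | .comp s q, A, h => by
    rw [opSubst]
    exact finiteLevels_opSubst s _ (finiteLevels_opSubst q _ h)

end

theorem exists_fresh [Infinite V] (M : Term V) (Γ : Ctx V) : ∃ b, b ∉ freeVars M ∧ b ∉ Γ := by
  obtain ⟨b, hb⟩ := ((finiteLevels_FV M).union (B := fun _ => {x | x ∈ Γ})
    (Set.Finite.subset (List.finite_toSet Γ)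
      (Set.iUnion_subset fun _ => subset_rfl))).exists_notMem
  rw [Set.iUnion_union_distrib] at hb
  exact ⟨b, fun h => hb (.inl h), fun h => hb (.inr (Set.mem_iUnion.2 ⟨0, h⟩))⟩

/-- `LookupAt Γ i x l`: the entry of `Γ` with de Bruijn index `i` is `x`, and `l` is the number
of entries of `Γ` that must be skipped by projections before `x` refers to this entry, that is,
`l - 1` is the index of the outermost entry `x` of `Γ` inside entry `i`, and `l = 0` if there is
none. -/
inductive LookupAt : Ctx V → ℕ → V → ℕ → Prop
  | here (Γ : Ctx V) (a : V) : LookupAt (a :: Γ) 0 a 0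
  | skip {Γ : Ctx V} {i : ℕ} {x c : V} : x ≠ c → LookupAt Γ i x 0 → LookupAt (c :: Γ) (i + 1) x 0
  | shift {Γ : Ctx V} {i l : ℕ} {x c : V} : l ≠ 0 ∨ x = c → LookupAt Γ i x l →
      LookupAt (c :: Γ) (i + 1) x (l + 1)

theorem LookupAt.getElem? {Γ : Ctx V} {i l : ℕ} {x : V} (h : LookupAt Γ i x l) :
    Γ[i]? = some x := by
  induction h with
  | here => rfl
  | skip _ _ ih => simpa using ih
  | shift _ _ ih => simpa using ih

theorem LookupAt.exists_shadow {Γ : Ctx V} {i l : ℕ} {x : V} (h : LookupAt Γ i x l)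
    (hl : l ≠ 0) : ∃ j < i, Γ[j]? = some x := by
  induction h with
  | here => exact absurd rfl hl
  | skip => exact absurd rfl hl
  | shift hc _ ih =>
    rcases hc with hc | rfl
    · obtain ⟨j, hj, e⟩ := ih hc
      exact ⟨j + 1, by omega, by simpa using e⟩
    · exact ⟨0, by omega, rfl⟩

/-- A typable variable refers to its innermost occurrence in the context. -/
theorem TermCorr.exists_lookupAt {Γ : Ctx V} {x : V} {U : NFTerm} (h : TermCorr Γ (.var x) U) :
    ∃ i, U = .idx i ∧ LookupAt Γ i x 0 := by
  induction Γ generalizing U with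
  | nil => cases h
  | cons c Γ ih =>
    cases h with
    | here => exact ⟨0, rfl, .here Γ _⟩
    | there _ hne h =>
      obtain ⟨i, e, hi⟩ := ih h
      cases e
      exact ⟨_, rfl, .skip hne hi⟩

/-- A string of projections is a weakening, and it moves free variables to higher levels. -/
theorem ProjString.lookupAt {p : Subst V} {a : V} (hp : ProjString p a) {Γ Δ : Ctx V}
    {v : NFSubst} (ht : SubstCorr Γ p Δ v) {i l : ℕ} {x : V} (h : LookupAt Δ i x l)
    (hl : l ≠ 0 ∨ x = a) {A : Levels V} (hA : x ∈ A l) :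
    ∃ i' l', denSubst v i = .var i' ∧ LookupAt Γ i' x l' ∧ l' ≠ 0 ∧ x ∈ opSubst p A l' := by
  induction hp generalizing Δ v i l A with
  | proj a =>
    cases ht
    exact ⟨i + 1, l + 1, rfl, .shift hl h, by omega, by simpa [opSubst, LambdaPi.opProj] using hA⟩
  | comp a hp ih =>
    cases ht with | comp ht hq =>
    cases hq
    obtain ⟨i', l', e, h', hl', hm⟩ := ih ht (.shift hl h) (.inl (Nat.succ_ne_zero l))
      (A := LambdaPi.opProj A) hA
    refine ⟨i', l', ?_, h', hl', ?_⟩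
    · simpa only [denSubst, Lam.subst] using e
    · simpa only [opSubst] using hm

theorem Leaf.lookupAt {M : Term V} (hM : Leaf M) {Γ : Ctx V} {U : NFTerm}
    (ht : TermCorr Γ M U) :
    ∃ i x l, den U = .var i ∧ LookupAt Γ i x l ∧ x ∈ FV M l ∧ (l = 0 → M = .var x) := by
  cases hM with
  | var x =>
    obtain ⟨i, rfl, h⟩ := ht.exists_lookupAt
    exact ⟨i, x, 0, rfl, h, by simp [FV, levelsVar], fun _ => rfl⟩
  | @clos p x hp =>
    cases ht with | clos ht hM =>
    obtain ⟨i, rfl, h⟩ := hM.exists_lookupAt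
    obtain ⟨i', l', e, h', hl', hm⟩ := hp.lookupAt ht h (.inr rfl) (A := FV (.var x))
      (by simp [FV, levelsVar])
    exact ⟨i', x, l', by simpa only [den, Lam.subst] using e, h',
      by simpa only [FV] using hm, fun h => absurd h hl'⟩

/-- The operator `O_{λ c}` follows the shift of indices and levels under a binder `c`. -/
theorem LookupAt.mem_opLam {Γ : Ctx V} {i l : ℕ} {x c : V} (h : LookupAt (c :: Γ) (i + 1) x l)
    {A : Levels V} (hA : x ∈ A l) : ∃ l', LookupAt Γ i x l' ∧ x ∈ opLam c A l' := by
  cases h with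
  | skip hne h => exact ⟨0, h, .inl ⟨hA, hne⟩⟩
  | @shift _ _ l _ _ _ h =>
    refine ⟨l, h, ?_⟩
    cases l with
    | zero => exact .inr hA
    | succ l => exact hA

/-- Every free index of the denotation of a seminormal term is visible in its free variables. -/
theorem SemiNormal.mem_FV {M : Term V} (hM : SemiNormal M) {Γ : Ctx V} {U : NFTerm}
    (ht : TermCorr Γ M U) {i : ℕ} (hi : (den U).Free i) :
    ∃ x l, LookupAt Γ i x l ∧ x ∈ FV M l := by
  induction hM generalizing Γ U i with
  | leaf hM =>
    obtain ⟨j, x, l, e, h, hm, -⟩ := hM.lookupAt ht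
    rw [e] at hi
    cases hi
    exact ⟨x, l, h, hm⟩
  | app _ _ ihM ihN =>
    cases ht with | app htM htN =>
    rcases hi with hi | hi
    · obtain ⟨x, l, h, hm⟩ := ihM htM hi
      exact ⟨x, l, h, by rw [FV]; exact .inl hm⟩
    · obtain ⟨x, l, h, hm⟩ := ihN htN hi
      exact ⟨x, l, h, by rw [FV]; exact .inr hm⟩
  | lam a _ ih =>
    cases ht with | lam ht =>
    obtain ⟨x, l, h, hm⟩ := ih ht hi
    obtain ⟨l', h', hm'⟩ := h.mem_opLam hm
    exact ⟨x, l', h', by rw [FV]; exact hm'⟩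

theorem LookupAt.mem_FV_lamCtx {Γ Δ : Ctx V} {M : Term V} {i l : ℕ} {x : V}
    (h : LookupAt (Δ ++ Γ) (i + Δ.length) x l) (hm : x ∈ FV M l) :
    ∃ l', LookupAt Γ i x l' ∧ x ∈ FV (lamCtx Δ M) l' := by
  induction Δ generalizing M l with
  | nil => exact ⟨l, h, hm⟩
  | cons c Δ ih =>
    obtain ⟨l', h', hm'⟩ := LookupAt.mem_opLam (i := i + Δ.length) h hm
    exact ih h' (by rw [FV]; exact hm')

/-- If a free index of a seminormal term passes over the entry `a` of the context and refers to
another entry `a`, then the side condition for renaming the former entry is satisfied. -/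
theorem SemiNormal.mem_freeVarsJ {M : Term V} (hM : SemiNormal M) {Γ Δ : Ctx V} {a : V}
    {U : NFTerm} (ht : TermCorr (Δ ++ a :: Γ) M U) {j : ℕ}
    (hj : (den U).Free (j + 1 + Δ.length)) (ha : Γ[j]? = some a) :
    a ∈ freeVarsJ (Δ ++ [a]) M := by
  obtain ⟨x, l, h, hm⟩ := hM.mem_FV ht hj
  have hlen : j + 1 + Δ.length = j + (Δ ++ [a]).length := by
    rw [List.length_append, List.length_singleton]
    omega
  rw [List.append_cons, hlen] at h
  obtain ⟨l', h', hm'⟩ := h.mem_FV_lamCtx hm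
  obtain rfl : x = a := Option.some.inj (h'.getElem?.symm.trans ha)
  exact Set.mem_iUnion.2 ⟨l', hm'⟩

/-! ### Normalization by renaming of shadowing variables -/

/-- No entry of `Γ` shadows an entry to which a free index of `T` refers, where the entries of
`Γ` have the indices `k, k + 1, …` in `T`. -/
def Unshadowed (Γ : Ctx V) (k : ℕ) (T : Lam) : Prop :=
  ∀ ⦃i j : ℕ⦄, i < j → T.Free (j + k) → ∀ x, Γ[i]? = some x → Γ[j]? ≠ some x

theorem Unshadowed.cons {Γ : Ctx V} {k : ℕ} {T : Lam} {a : V} (h : Unshadowed Γ (k + 1) T)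
    (ha : ∀ j, T.Free (j + 1 + k) → Γ[j]? ≠ some a) : Unshadowed (a :: Γ) k T := by
  intro i j hij hj x hi
  obtain ⟨j, rfl⟩ : ∃ j', j = j' + 1 := ⟨j - 1, by omega⟩
  cases i with
  | zero =>
    obtain rfl : a = x := by simpa using hi
    simpa using ha j hj
  | succ i => exact h (i := i) (by omega) (by rwa [Nat.add_right_comm] at hj) x (by simpa using hi)

/-- Terms without explicit substitutions. -/
inductive Pure : Term V → Prop
  | var (a : V) : Pure (.var a)
  | app {M N : Term V} : Pure M → Pure N → Pure (.app M N)
  | lam {M : Term V} (a : V) : Pure M → Pure (.lam a M)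

theorem Pure.eq_toNF {M : Term V} (hM : Pure M) {Γ : Ctx V} {U : NFTerm} (ht : TermCorr Γ M U) :
    U = (den U).toNF := by
  induction hM generalizing Γ U with
  | var a =>
    obtain ⟨i, rfl, -⟩ := ht.exists_lookupAt
    rfl
  | app _ _ ihM ihN =>
    cases ht with | app htM htN =>
    simp only [den, Lam.toNF, ← ihM htM, ← ihN htN]
  | lam a _ ih =>
    cases ht with | lam ht =>
    simp only [den, Lam.toNF, ← ih ht]

theorem getElem?_ne_of_notMem {Γ : Ctx V} {b : V} (hb : b ∉ Γ) (j : ℕ) : Γ[j]? ≠ some b :=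
  fun h => hb (List.mem_of_getElem? h)

/-- In an unshadowed context the bound variables can be renamed from the outside to the inside.
The induction is on the denotation, which the renaming does not change. -/
theorem exists_pure_of_unshadowed [Infinite V] (T : Lam) {Γ : Ctx V} {M : Term V} {U : NFTerm}
    (hM : SemiNormal M) (ht : TermCorr Γ M U) (hT : den U = T) (hu : Unshadowed Γ 0 T) :
    ∃ N, TermRed M N ∧ Pure N := by
  induction T generalizing Γ M U with
  | var i =>
    cases hM with
    | leaf hM =>
      obtain ⟨j, x, l, e, h, -, hl⟩ := hM.lookupAt ht
      obtain rfl : j = i := Lam.var.inj (e.symm.trans hT)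
      by_cases h0 : l = 0
      · exact ⟨M, .refl, by rw [hl h0]; exact .var x⟩
      · obtain ⟨k, hk, hx⟩ := h.exists_shadow h0
        exact absurd h.getElem? (hu hk rfl x hx)
    | app => cases ht; cases hT
    | lam => cases ht; cases hT
  | app S T ihS ihT =>
    cases hM with
    | leaf hM =>
      obtain ⟨j, x, l, e, -⟩ := hM.lookupAt ht
      cases e.symm.trans hT
    | app hM hN =>
      cases ht with | app htM htN =>
      injection hT with hS hT
      obtain ⟨M', hM', hp⟩ := ihS hM htM hS fun i j hij hj => hu hij (.inl hj)
      obtain ⟨N', hN', hp'⟩ := ihT hN htN hT fun i j hij hj => hu hij (.inr hj)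
      exact ⟨_, hM'.app hN', .app hp hp'⟩
    | lam => cases ht; cases hT
  | lam T ih =>
    cases hM with
    | leaf hM =>
      obtain ⟨j, x, l, e, -⟩ := hM.lookupAt ht
      cases e.symm.trans hT
    | app => cases ht; cases hT
    | @lam M a hM =>
      cases ht with | @lam _ _ _ U ht =>
      injection hT with hT
      subst hT
      have hu' : Unshadowed Γ 1 (den U) := fun i j hij hj => hu hij hj
      by_cases hs : ∃ j, (den U).Free (j + 1) ∧ Γ[j]? = some a
      · obtain ⟨j, hj, ha⟩ := hs
        -- `b ∉ Γ`, which the side condition does not require, prevents `b` from shadowing.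
        obtain ⟨b, hb, hbΓ⟩ := exists_fresh (.lam a M) Γ
        obtain ⟨W, hW, e⟩ := corr_lift (Δ := []) b ht
        obtain ⟨N, hN, hn⟩ := hW.exists_semiNormal
        obtain ⟨W', hW', e'⟩ := hN.sound hW
        obtain ⟨L, hL, hp⟩ := ih hn hW' (e'.trans e)
          (hu'.cons fun j _ => getElem?_ne_of_notMem hbΓ j)
        exact ⟨_, .head (.Alpha₁ a b M (hM.mem_freeVarsJ (Δ := []) ht hj ha) hb)
          (TermRed.lam b (hN.trans hL)), .lam b hp⟩
      · obtain ⟨L, hL, hp⟩ := ih hM ht rfl (hu'.cons fun j hj ha => hs ⟨j, hj, ha⟩)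
        exact ⟨_, hL.lam a, .lam a hp⟩

/-- The entries of the part `Γ` of a context can be renamed, from the outside to the inside, so
that it becomes unshadowed. -/
theorem exists_unshadowed [Infinite V] (Γ : Ctx V) {Δ : Ctx V} {M : Term V} {U : NFTerm}
    (ht : TermCorr (Δ ++ Γ) M U) :
    ∃ Γ' N W, Reduces .sigmaPiAlpha ⟨Δ ++ Γ, M⟩ ⟨Δ ++ Γ', N⟩ ∧ TermCorr (Δ ++ Γ') N W ∧
      SemiNormal N ∧ Unshadowed Γ' Δ.length (den W) := by
  induction Γ generalizing Δ M U with
  | nil =>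
    obtain ⟨N, hN, hn⟩ := ht.exists_semiNormal
    obtain ⟨W, hW, e⟩ := hN.sound ht
    exact ⟨[], N, W, Reduces.of_termRed _ hN, hW, hn, fun _ _ _ _ _ h => by simp at h⟩
  | cons a Γ ih =>
    rw [List.append_cons] at ht
    obtain ⟨Γ', N, W, hr, hW, hn, hu⟩ := ih ht
    rw [← List.append_cons, ← List.append_cons] at hr
    rw [← List.append_cons] at hW
    rw [List.length_append, List.length_singleton] at hu
    by_cases hs : ∃ j, (den W).Free (j + 1 + Δ.length) ∧ Γ'[j]? = some a
    · obtain ⟨j, hj, ha⟩ := hs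
      obtain ⟨b, hb, hbΓ⟩ := exists_fresh (lamCtx (Δ ++ [a]) N) Γ'
      obtain ⟨W₁, hW₁, e₁⟩ := corr_lift b hW
      obtain ⟨L, hL, hl⟩ := hW₁.exists_semiNormal
      obtain ⟨W₂, hW₂, e₂⟩ := hL.sound hW₁
      refine ⟨b :: Γ', L, W₂, (hr.tail (.Alpha₂ _ _ _ b _ (hn.mem_freeVarsJ hW hj ha) hb)).trans
        (Reduces.of_termRed _ hL), hW₂, hl, ?_⟩
      rw [e₂, e₁]
      exact hu.cons fun j _ => getElem?_ne_of_notMem hbΓ j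
    · exact ⟨a :: Γ', N, W, hr, hW, hn, hu.cons fun j hj ha => hs ⟨j, hj, ha⟩⟩

/-- Every typable judgement reduces to one that corresponds to the denotation. -/
theorem exists_reduces_toNF [Infinite V] {Γ : Ctx V} {M : Term V} {U : NFTerm}
    (ht : TermCorr Γ M U) :
    ∃ Γ' N, Reduces .sigmaPiAlpha ⟨Γ, M⟩ ⟨Γ', N⟩ ∧ TermCorr Γ' N (den U).toNF := by
  obtain ⟨Γ', N, W, hr, hW, hn, hu⟩ := exists_unshadowed Γ (Δ := []) ht
  obtain ⟨L, hL, hp⟩ := exists_pure_of_unshadowed _ hn hW rfl hu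
  have hr' := hr.trans (Reduces.of_termRed _ hL)
  obtain ⟨-, W', hW', e⟩ := Reduces.sound hr' ht
  refine ⟨Γ', L, hr', ?_⟩
  have h := hp.eq_toNF hW'
  rw [e] at h
  exact h ▸ hW'

end LambdaPi

theorem mainTheorem2 {V : Type*} [Infinite V]
    (Γ₁ Γ₂ Δ₁ Δ₂ : LambdaPi.Ctx V) (M₁ M₂ N₁ N₂ : LambdaPi.Term V)
    (hα : LambdaPi.AlphaEq ⟨Γ₁, M₁⟩ ⟨Γ₂, M₂⟩)
    (h₁ : LambdaPi.Reduces LambdaPi.Calculus.sigmaPiAlpha ⟨Γ₁, M₁⟩ ⟨Δ₁, N₁⟩)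
    (h₂ : LambdaPi.Reduces LambdaPi.Calculus.sigmaPiAlpha ⟨Γ₂, M₂⟩ ⟨Δ₂, N₂⟩) :
    ∃ (S₁ S₂ : LambdaPi.Ctx V) (L₁ L₂ : LambdaPi.Term V),
      LambdaPi.Reduces LambdaPi.Calculus.sigmaPiAlpha ⟨Δ₁, N₁⟩ ⟨S₁, L₁⟩ ∧
      LambdaPi.Reduces LambdaPi.Calculus.sigmaPiAlpha ⟨Δ₂, N₂⟩ ⟨S₂, L₂⟩ ∧
      LambdaPi.AlphaEq ⟨S₁, L₁⟩ ⟨S₂, L₂⟩ := by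
  obtain ⟨m, U, ⟨hl₁, ht₁⟩, hl₂, ht₂⟩ := hα
  obtain ⟨hm₁, U₁, hU₁, e₁⟩ := LambdaPi.Reduces.sound h₁ ht₁
  obtain ⟨hm₂, U₂, hU₂, e₂⟩ := LambdaPi.Reduces.sound h₂ ht₂
  obtain ⟨S₁, L₁, hr₁, hL₁⟩ := LambdaPi.exists_reduces_toNF hU₁
  obtain ⟨S₂, L₂, hr₂, hL₂⟩ := LambdaPi.exists_reduces_toNF hU₂
  rw [e₁] at hL₁
  rw [e₂] at hL₂
  exact ⟨S₁, S₂, L₁, L₂, hr₁, hr₂, m, (LambdaPi.den U).toNF,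
    ⟨(LambdaPi.Reduces.sound hr₁ hU₁).1.trans (hm₁.trans hl₁), hL₁⟩,
    ⟨(LambdaPi.Reduces.sound hr₂ hU₂).1.trans (hm₂.trans hl₂), hL₂⟩⟩
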